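/- Let $N\in\mathbb N$, let $\mathcal E_1,\dots,\mathcal E_N\in\mathbb R$ with $\sum_i\mathcal E_i=0$, let $\tilde H_0=\mathrm{diag}(\mathcal E_1,\dots,\mathcal E_N)$, let $\tilde H_1$ be a traceless Hermitian $N\times N$ matrix, and put $A=-i\tilde H_0$, $B=(b_{jk})=-i\tilde H_1\in\mathfrak{su}(N)$. Consider the control system $$\dot X(t)=(A+u(t)B)\,X(t),\qquad X(t)\in SU(N),\qquad X(0)=I,$$ with piecewise constant inputs $u$ with values in $\mathbb R$. The system is called controllable if every $\bar X\in SU(N)$ equals $X(t)$ for some $t\ge 0$ and some input $u$. For a matrix $M=(m_{jk})$ that is Hermitian or skew-Hermitian, $\mathcal G_M$ is the graph on $\{1,\dots,N\}$ in which $j\ne k$ are joined if and only if $m_{jk}\ne0$. Let $\Delta=\{(j,k): j\neq k\}$ be the set of roots, where $\alpha=(j,k)$ takes the value $\alpha(H)=h_j-h_k$ at a diagonal matrix $H=\mathrm{diag}(h_1,\dots,h_N)$, and let $\Gamma=\{(j,k)\in\Delta : b_{jk}\ne 0\}$. Call a root $\alpha$ regular for $H$ if $\alpha(H)\ne\beta(H)$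 for every root $\beta\in\Delta$ with $\beta\neq\alpha$. Let $B_0$ be the diagonal part of $B$ and $C=[A,B]$. Let $B_r$ be the sum of $B_0$ and the matrix whose $(j,k)$ entry is $b_{jk}$ if $(j,k)\in\Gamma$ is regular for $A$ and $0$ otherwise; let $C_r$ be the matrix whose $(j,k)$ entry is that of $C$ if $(j,k)\in\Gamma$ is regular for $B_0$ and $0$ otherwise. Assume $\mathcal E_i\ne\mathcal E_j$ for $i\neq j$ and that $\mathcal G_B$ is connected. If $\mathcal G_{B_r}\cup\mathcal G_{C_r}$ is connected, then the system is controllable. The same holds if, in the definitions of $B_r$ and $C_r$, the regularity of a root $\alpha\in\Gamma$ is tested only against the other roots $\beta\in\Gamma$ instead of all $\beta\in\Delta$. -/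

import Mathlib

open scoped Matrix Topology

noncomputable section

namespace QuantumControl

/-! ## The control system on `SU(N)` -/

/-- Admissible inputs on `[0, t]`: piecewise constant functions with finitely many switching
times. The values are arbitrary real numbers. -/
def IsAdmissibleInput (t : ℝ) (u : ℝ → ℝ) : Prop :=
  ∃ F : Finset ℝ, ∀ s ∈ Set.Ioo 0 t, s ∉ F → ∀ᶠ s' in 𝓝 s, u s' = u s

/-- `X` is the integral curve on `[0, t]`, in `SU(N)` and starting at the identity, of
`X' = (A + u B) X`. As `u` may jump, `X` is continuous and solves the equation away from a finite
set of times. -/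
def IsIntegralCurve {N : ℕ} (A B : Matrix (Fin N) (Fin N) ℂ) (t : ℝ) (u : ℝ → ℝ)
    (X : ℝ → Matrix (Fin N) (Fin N) ℂ) : Prop :=
  ContinuousOn X (Set.Icc 0 t) ∧ X 0 = 1 ∧
    (∀ s ∈ Set.Icc 0 t, X s ∈ Matrix.specialUnitaryGroup (Fin N) ℂ) ∧
    ∃ F : Finset ℝ, ∀ s ∈ Set.Ioo 0 t, s ∉ F → HasDerivAt X ((A + u s • B) * X s) s

/-- The set of points of `SU(N)` that the system `X' = (A + u B) X`, `X(0) = I`, reaches at some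
time `t ≥ 0` under some admissible input. -/
def reachableSet {N : ℕ} (A B : Matrix (Fin N) (Fin N) ℂ) : Set (Matrix (Fin N) (Fin N) ℂ) :=
  {Y | Y ∈ Matrix.specialUnitaryGroup (Fin N) ℂ ∧
    ∃ t : ℝ, 0 ≤ t ∧ ∃ u : ℝ → ℝ, IsAdmissibleInput t u ∧
      ∃ X : ℝ → Matrix (Fin N) (Fin N) ℂ, IsIntegralCurve A B t u X ∧ X t = Y}

/-- Global controllability: every element of `SU(N)` is reachable from the identity. -/
def IsControllable {N : ℕ} (A B : Matrix (Fin N) (Fin N) ℂ) : Prop :=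
  reachableSet A B = {Y | Y ∈ Matrix.specialUnitaryGroup (Fin N) ℂ}

/-- The drift `A = -i H₀`, where `H₀` is diagonal with the energy levels `E` as entries. -/
def drift {N : ℕ} (E : Fin N → ℝ) : Matrix (Fin N) (Fin N) ℂ :=
  -Complex.I • Matrix.diagonal fun i => (E i : ℂ)

/-- The graph of a (Hermitian or skew-Hermitian) matrix: distinct nodes `i`, `j` are joined if and
only if the `(i, j)` or the `(j, i)` entry is nonzero. Loops do not matter for connectivity. -/
def graph {N : ℕ} (M : Matrix (Fin N) (Fin N) ℂ) : SimpleGraph (Fin N) :=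
  SimpleGraph.fromRel fun i j => M i j ≠ 0

/-! ## Roots. The root `α_{ij}` of `sl(N, ℂ)` is encoded by the pair `(i, j)`, `i ≠ j`. -/

/-- The set `Δ` of all (positive and negative) roots. -/
def roots (N : ℕ) : Set (Fin N × Fin N) := {p | p.1 ≠ p.2}

/-- The roots touched by `B`: the set `Γ = Γ⁺ ∪ -Γ⁺`, for skew-Hermitian `B`. -/
def touchedRoots {N : ℕ} (B : Matrix (Fin N) (Fin N) ℂ) : Set (Fin N × Fin N) :=
  {p | p.1 ≠ p.2 ∧ B p.1 p.2 ≠ 0}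

/-- The value `α_{ij}(H) = h_i - h_j` of a root at a diagonal matrix `H`. -/
def rootValue {N : ℕ} (p : Fin N × Fin N) (H : Matrix (Fin N) (Fin N) ℂ) : ℂ :=
  H p.1 p.1 - H p.2 p.2

/-- The roots in `R` that are regular for the diagonal matrix `H`: their value at `H` differs from
the values of all other roots in `R`. When `R = -R` the condition covers the opposite root, so
that a regular root has a nonzero value, and `p` is regular if and only if `-p` is. -/
def regularRoots {N : ℕ} (R : Set (Fin N × Fin N)) (H : Matrix (Fin N) (Fin N) ℂ) :
    Set (Fin N × Fin N) :=
  {p | p ∈ R ∧ ∀ q ∈ R, q ≠ p → rootValue q H ≠ rootValue p H}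

open Classical in
/-- The part of `M` along a set `S` of roots: the entries with index in `S` are kept, and all the
others are replaced by zero. -/
def partAlong {N : ℕ} (S : Set (Fin N × Fin N)) (M : Matrix (Fin N) (Fin N) ℂ) :
    Matrix (Fin N) (Fin N) ℂ :=
  Matrix.of fun i j => if (i, j) ∈ S then M i j else 0

/-- The diagonal part `B₀` of `B`. -/
def diagPart {N : ℕ} (B : Matrix (Fin N) (Fin N) ℂ) : Matrix (Fin N) (Fin N) ℂ :=
  Matrix.diagonal fun i => B i i

/-- `B_r = B₀ + ∑ (b_α E_α - b_α^* E_{-α})`, the sum over the positive roots touched by `B` that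
are regular for `A` among the roots in `R`. -/
def regularPartB {N : ℕ} (R : Set (Fin N × Fin N)) (A B : Matrix (Fin N) (Fin N) ℂ) :
    Matrix (Fin N) (Fin N) ℂ :=
  diagPart B + partAlong (touchedRoots B ∩ regularRoots R A) B

/-- The level one bracket `C = [A, B] = ∑ α(A) (b_α E_α + b_α^* E_{-α})`. -/
def bracketC {N : ℕ} (A B : Matrix (Fin N) (Fin N) ℂ) : Matrix (Fin N) (Fin N) ℂ :=
  A * B - B * A

/-- `C_r = ∑ α(A) (b_α E_α + b_α^* E_{-α})`, the sum over the positive roots touched by `B` that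
are regular for `B₀` among the roots in `R`. -/
def regularPartC {N : ℕ} (R : Set (Fin N × Fin N)) (A B : Matrix (Fin N) (Fin N) ℂ) :
    Matrix (Fin N) (Fin N) ℂ :=
  partAlong (touchedRoots B ∩ regularRoots R (diagPart B)) (bracketC A B)

end QuantumControl

end

/-! The proof combines an algebraic and a topological argument.

Algebra: every real Lie algebra L containing A and B contains su(N). Bracketing twice with diag(i d)
multiplies the (j, k) entry by -(d_j - d_k)², so polynomial interpolation separates entries by their
squared root value (`filter_mem`). At a regular root only one pair of entries survives, which yields
its whole root space (`rootMatrix_mem_of_regular`). Since the energies are distinct, B₀ also lies in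
L, so this applies to B with A as diagonal element and to C with B₀. Brackets along paths of the
connected graph then give every root space, hence su(N) (`mem_of_connected_rootMatrix`).

Topology: the reachable set is a semigroup S in SU(N) containing all exp(t(A + uB)), t ≥ 0. By
compactness its closure is a group (`star_mem_topologicalClosure`). Smooth families in S can be
extended until their velocities fill su(N) (`exists_isVelocitySpace`), so S has interior in SU(N).
The closure then contains a neighbourhood of 1, hence all of SU(N), and a dense semigroup with
interior is the whole group (`eq_specialUnitaryGroup`). -/

noncomputable section

namespace QuantumControl

open Matrix
open scoped Matrix.Norms.L2Operator

variable {N : ℕ}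

/-! ### Root spaces and the Lie algebras they generate -/

/-- The skew-Hermitian matrix `z E_ab - z̄ E_ba` in the root space of `±(a, b)`. -/
def rootMatrix (a b : Fin N) (z : ℂ) : Matrix (Fin N) (Fin N) ℂ :=
  single a b z - single b a (star z)

lemma rootMatrix_swap (a b : Fin N) (z : ℂ) : rootMatrix a b z = rootMatrix b a (-star z) := by
  simp [rootMatrix, single_neg, sub_eq_add_neg, add_comm]

lemma rootMatrix_add (a b : Fin N) (z w : ℂ) :
    rootMatrix a b (z + w) = rootMatrix a b z + rootMatrix a b w := by
  simp only [rootMatrix, star_add, single_add]; abel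

lemma rootMatrix_real_smul (a b : Fin N) (r : ℝ) (z : ℂ) :
    rootMatrix a b (r * z) = r • rootMatrix a b z := by
  simp [rootMatrix, smul_sub, smul_single]

lemma commutator_rootMatrix {a b c : Fin N} (hab : a ≠ b) (hbc : b ≠ c) (hac : a ≠ c) (z w : ℂ) :
    rootMatrix a b z * rootMatrix b c w - rootMatrix b c w * rootMatrix a b z =
      rootMatrix a c (z * w) := by
  simp [rootMatrix, mul_sub, sub_mul, hab, hbc, hac, hab.symm, hbc.symm, hac.symm, mul_comm]

lemma commutator_rootMatrix_diagonal (d : Fin N → ℝ) (a b : Fin N) (z : ℂ) :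
    diagonal (fun i => Complex.I * d i) * rootMatrix a b z -
      rootMatrix a b z * diagonal (fun i => Complex.I * d i) =
      rootMatrix a b ((d a - d b : ℝ) * (Complex.I * z)) := by
  ext i j
  simp only [rootMatrix, Matrix.sub_apply, diagonal_mul, mul_diagonal, single_apply]
  by_cases h1 : a = i ∧ b = j
  · obtain ⟨rfl, rfl⟩ := h1
    by_cases h2 : b = a ∧ a = b
    · simp [h2.1]
      ring
    · simp only [h2, and_self, if_true, if_false, sub_zero, Complex.ofReal_sub]
      ring
  · by_cases h2 : b = i ∧ a = j
    · obtain ⟨rfl, rfl⟩ := h2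
      simp [h1]
      ring
    · simp [h1, h2]

/-- Independent elements of one root space bracket into the diagonal. Both orders of the product
contribute equally, whence `r / 2`. -/
lemma commutator_rootMatrix_same {a b : Fin N} (hab : a ≠ b) (r : ℝ) :
    rootMatrix a b (r / 2) * rootMatrix a b Complex.I -
      rootMatrix a b Complex.I * rootMatrix a b (r / 2) =
      single a a (r * Complex.I) - single b b (r * Complex.I) := by
  have h : (r : ℂ) * Complex.I = r / 2 * Complex.I + r / 2 * Complex.I := by ring
  rw [h]
  simp only [rootMatrix, mul_sub, sub_mul, RCLike.star_def, Complex.conj_I, ← single_neg, mul_neg,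
    neg_mul, single_mul_single_same, single_add, ne_eq, hab, hab.symm, not_false_eq_true,
    single_mul_single_of_ne, mul_comm Complex.I, map_div₀, Complex.conj_ofReal, Complex.conj_ofNat]
  abel

/-- A subspace containing `diag (i d)`-commutators allows to rescale the entries of its elements
by any function of the squared root values. -/
lemma filter_mem (L : Submodule ℝ (Matrix (Fin N) (Fin N) ℂ)) (d : Fin N → ℝ)
    (hD : ∀ M ∈ L, diagonal (fun i => Complex.I * d i) * M -
      M * diagonal (fun i => Complex.I * d i) ∈ L)
    {M : Matrix (Fin N) (Fin N) ℂ} (hM : M ∈ L) (f : ℝ → ℝ) :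
    of (fun j k => f ((d j - d k) ^ 2) • M j k) ∈ L := by
  have hpoly : ∀ P : Polynomial ℝ, of (fun j k => P.eval ((d j - d k) ^ 2) • M j k) ∈ L := by
    have hpow : ∀ n : ℕ, of (fun j k => ((d j - d k) ^ 2) ^ n • M j k) ∈ L := by
      intro n
      induction n with
      | zero =>
        convert hM using 1
        ext; simp
      | succ n ih =>
        -- One commutator gives the factor i(d_j - d_k), two give -(d_j - d_k)²; only the latter is
        -- real, as scalars of `L` must be.
        convert L.neg_mem (hD _ (hD _ ih)) using 1
        ext j k
        simp only [Matrix.sub_apply, Matrix.neg_apply, diagonal_mul, mul_diagonal, of_apply, Complex.real_smul]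
        push_cast
        linear_combination ((d j - d k : ℂ) ^ 2 * ((d j - d k) ^ 2) ^ n * M j k) * Complex.I_sq
    intro P
    induction P using Polynomial.induction_on' with
    | add p q hp hq =>
      convert L.add_mem hp hq using 1
      ext; simp [add_mul]
    | monomial n r =>
      convert L.smul_mem r (hpow n) using 1
      ext; simp [mul_assoc]
  -- Only finitely many squared root values occur, so `f` agrees on them with a polynomial.
  let s : Finset ℝ := Finset.univ.image fun p : Fin N × Fin N => (d p.1 - d p.2) ^ 2
  convert hpoly (Lagrange.interpolate s id f) using 1
  ext j k
  have := Lagrange.eval_interpolate_at_node (s := s) (v := id) f (Function.injective_id.injOn)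
    (Finset.mem_image_of_mem _ (Finset.mem_univ (j, k)))
  simp only [id] at this
  simp only [of_apply]
  rw [← this]

/-- If `(a, b)` takes at `diag (i d)` a value different from those of the other roots in the
support of `M`, then `diag (i d)` and `M` generate the root space of `±(a, b)`. -/
lemma rootMatrix_mem_of_regular (L : Submodule ℝ (Matrix (Fin N) (Fin N) ℂ)) (d : Fin N → ℝ)
    (hD : ∀ M ∈ L, diagonal (fun i => Complex.I * d i) * M -
      M * diagonal (fun i => Complex.I * d i) ∈ L)
    {M : Matrix (Fin N) (Fin N) ℂ} (hM : M ∈ L) (hskew : ∀ i j, M j i = -star (M i j))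
    {a b : Fin N} (hab : a ≠ b) (hMab : M a b ≠ 0)
    (hreg : ∀ j k, j ≠ k → M j k ≠ 0 → (j, k) ≠ (a, b) → d j - d k ≠ d a - d b) (z : ℂ) :
    rootMatrix a b z ∈ L := by
  classical
  -- By skewness (b, a) is in the support too, and a vanishing value would be shared by both roots.
  have hne : d a - d b ≠ 0 := by
    intro h0
    refine hreg b a hab.symm (by rw [hskew]; simpa using hMab) (by simp [hab, hab.symm]) ?_
    linarith
  -- By regularity, the indicator of the squared value keeps exactly the entries (a, b) and (b, a).
  have h1 : rootMatrix a b (M a b) ∈ L := by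
    convert filter_mem L d hD hM (fun x => if x = (d a - d b) ^ 2 then 1 else 0) using 1
    ext j k
    simp only [rootMatrix, Matrix.sub_apply, single_apply, of_apply]
    by_cases h1 : a = j ∧ b = k
    · obtain ⟨rfl, rfl⟩ := h1
      simp [hab, hab.symm]
    by_cases h2 : b = j ∧ a = k
    · obtain ⟨rfl, rfl⟩ := h2
      have : (d b - d a) ^ 2 = (d a - d b) ^ 2 := by ring
      simp [hab, hab.symm, this, hskew a b]
    rw [if_neg h1, if_neg h2]
    split_ifs with h3
    · by_cases hjk : j = k
      · subst hjk
        simp only [sub_self, ne_eq, OfNat.ofNat_ne_zero, not_false_eq_true, zero_pow] at h3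
        exact absurd (pow_eq_zero_iff two_ne_zero |>.1 h3.symm) hne
      · by_contra hM0
        have hM1 : M j k ≠ 0 := by intro h; simp [h] at hM0
        rcases sq_eq_sq_iff_eq_or_eq_neg.1 h3 with h | h
        · exact hreg j k hjk hM1 (by rintro ⟨⟩; exact h1 ⟨rfl, rfl⟩) h
        · exact hreg k j (Ne.symm hjk) (by rw [hskew]; simpa using hM1)
            (by rintro ⟨⟩; exact h2 ⟨rfl, rfl⟩) (by linarith)
    · simp
  -- A further commutator rotates the coefficient by i; `M a b` and i `M a b` span ℂ over ℝ.
  have h2 := hD _ h1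
  rw [commutator_rootMatrix_diagonal, rootMatrix_real_smul] at h2
  have h3 := L.smul_mem (d a - d b)⁻¹ h2
  rw [smul_smul, inv_mul_cancel₀ hne, one_smul] at h3
  have h4 : z = (z / M a b).re * M a b + (z / M a b).im * (Complex.I * M a b) := by
    conv_lhs => rw [← div_mul_cancel₀ z hMab, ← Complex.re_add_im (z / M a b)]
    ring
  rw [h4, rootMatrix_add, rootMatrix_real_smul, rootMatrix_real_smul]
  exact L.add_mem (L.smul_mem _ h1) (L.smul_mem _ h3)

lemma eq_neg_star_of_conjTranspose_eq_neg {M : Matrix (Fin N) (Fin N) ℂ} (hM : Mᴴ = -M)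
    (i j : Fin N) : M j i = -star (M i j) := by
  have := congrFun (congrFun hM j) i
  rw [conjTranspose_apply, Matrix.neg_apply] at this
  rw [this, neg_neg]

/-- A real Lie algebra that contains the root spaces along the edges of a connected graph
contains all traceless skew-Hermitian matrices. -/
lemma mem_of_connected_rootMatrix (L : Submodule ℝ (Matrix (Fin N) (Fin N) ℂ))
    (hL : ∀ X ∈ L, ∀ Y ∈ L, X * Y - Y * X ∈ L) (G : SimpleGraph (Fin N)) (hG : G.Connected)
    (hadj : ∀ a b, G.Adj a b → ∀ z, rootMatrix a b z ∈ L)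
    {M : Matrix (Fin N) (Fin N) ℂ} (hM : Mᴴ = -M) (htr : M.trace = 0) : M ∈ L := by
  have hroot : ∀ a b, a ≠ b → ∀ z, rootMatrix a b z ∈ L := by
    intro a b
    obtain ⟨w⟩ := hG.preconnected a b
    -- Along a walk, the bracket of the (u, v) and (v, w) root spaces lies in that of (u, w).
    induction w with
    | nil => intro h; exact absurd rfl h
    | @cons u v w h p ih =>
      intro huw z
      by_cases hvw : v = w
      · subst hvw; exact hadj _ _ h z
      · have := hL _ (hadj _ _ h z) _ (ih hvw 1)
        rwa [commutator_rootMatrix h.ne hvw huw, mul_one] at this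
  have hentry := eq_neg_star_of_conjTranspose_eq_neg hM
  obtain ⟨o⟩ := hG.nonempty
  have hdiag : ∀ i, single i i (M i i) - single o o (M i i) ∈ L := by
    intro i
    by_cases hi : i = o
    · subst hi; simp
    · have h1 : M i i = (M i i).im * Complex.I := by
        have h2 := congrArg Complex.re (hentry i i)
        simp only [Complex.neg_re, RCLike.star_def, Complex.conj_re] at h2
        apply Complex.ext <;> simp
        linarith
      rw [h1, ← commutator_rootMatrix_same hi]
      exact hL _ (hroot _ _ hi _) _ (hroot _ _ hi _)
  -- Summing over ordered pairs counts each off-diagonal entry twice, whence 1/2. The corrections at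
  -- (o, o) add up to the trace, which is zero.
  have hsum : M = ∑ i, ∑ j, (if i = j then 0 else (1 / 2 : ℝ) • rootMatrix i j (M i j)) +
      ∑ i, (single i i (M i i) - single o o (M i i)) := by
    have h0 : ∑ i, (single o o (M i i) : Matrix (Fin N) (Fin N) ℂ) = 0 := by
      have : ∑ i, (single o o (M i i) : Matrix (Fin N) (Fin N) ℂ) = single o o (∑ i, M i i) :=
        (map_sum (singleAddMonoidHom (α := ℂ) o o) _ _).symm
      rw [this]
      have : ∑ i, M i i = 0 := htr
      rw [this, single_zero]
    rw [Finset.sum_sub_distrib, h0, sub_zero]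
    have h1 : ∑ i, single i i (M i i) =
        ∑ i, ∑ j, (if i = j then (1 / 2 : ℝ) • rootMatrix i j (M i j) else 0) := by
      refine Finset.sum_congr rfl fun i _ => ?_
      rw [Finset.sum_ite_eq]
      simp only [Finset.mem_univ, if_true, rootMatrix]
      have : star (M i i) = - M i i := by
        conv_rhs => rw [hentry i i, neg_neg]
      rw [this, ← single_neg, sub_neg_eq_add, ← two_smul ℝ, smul_smul]
      norm_num
    rw [h1, ← Finset.sum_add_distrib]
    have h2 : ∀ i, ∑ j, (if i = j then 0 else (1 / 2 : ℝ) • rootMatrix i j (M i j)) +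
        ∑ j, (if i = j then (1 / 2 : ℝ) • rootMatrix i j (M i j) else 0) =
        ∑ j, ((1 / 2 : ℝ) • single i j (M i j) + (1 / 2 : ℝ) • single j i (M j i)) := by
      intro i
      rw [← Finset.sum_add_distrib]
      refine Finset.sum_congr rfl fun j _ => ?_
      have : (if i = j then 0 else (1 / 2 : ℝ) • rootMatrix i j (M i j)) +
        (if i = j then (1 / 2 : ℝ) • rootMatrix i j (M i j) else 0) =
          (1 / 2 : ℝ) • rootMatrix i j (M i j) := by split_ifs <;> simp
      rw [this, rootMatrix, hentry i j, ← smul_add, ← single_neg, sub_eq_add_neg]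
    simp only [h2, Finset.sum_add_distrib]
    rw [Finset.sum_comm (f := fun i j => (1 / 2 : ℝ) • single j i (M j i))]
    simp only [← Finset.smul_sum]
    rw [← matrix_eq_sum_single, ← add_smul]
    norm_num
  rw [hsum]
  refine L.add_mem (L.sum_mem fun i _ => L.sum_mem fun j _ => ?_) (L.sum_mem fun i _ => hdiag i)
  split_ifs with h
  · exact L.zero_mem
  · exact L.smul_mem _ (hroot i j h _)

/-! ### The Lie algebra rank condition -/

lemma drift_eq_diagonal (E : Fin N → ℝ) :
    drift E = diagonal fun i => Complex.I * ((-E i : ℝ) : ℂ) := by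
  ext i j
  by_cases h : i = j <;> simp [drift, h]

lemma diagPart_eq_diagonal {B : Matrix (Fin N) (Fin N) ℂ} (hB : Bᴴ = -B) :
    diagPart B = diagonal fun i => Complex.I * ((B i i).im : ℂ) := by
  ext i j
  by_cases h : i = j
  · subst h
    have h2 := congrArg Complex.re (eq_neg_star_of_conjTranspose_eq_neg hB i i)
    simp only [Complex.neg_re, RCLike.star_def, Complex.conj_re] at h2
    have h3 : (B i i).re = 0 := by linarith
    apply Complex.ext <;> simp [diagPart, h3]
  · simp [diagPart, h]

lemma rootValue_diagonal (d : Fin N → ℝ) (p : Fin N × Fin N) :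
    rootValue p (diagonal fun i => Complex.I * (d i : ℂ)) =
      Complex.I * ((d p.1 - d p.2 : ℝ) : ℂ) := by
  simp [rootValue, mul_sub]

/-- As the energies are distinct, only diagonal positions have squared root value 0 at A. Filtering
these out of `B` and subtracting the result leaves B₀. -/
lemma diagPart_mem (L : Submodule ℝ (Matrix (Fin N) (Fin N) ℂ))
    (hL : ∀ X ∈ L, ∀ Y ∈ L, X * Y - Y * X ∈ L) {E : Fin N → ℝ}
    (hE : ∀ i j : Fin N, i ≠ j → E i ≠ E j) {B : Matrix (Fin N) (Fin N) ℂ}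
    (hA : drift E ∈ L) (hB : B ∈ L) : diagPart B ∈ L := by
  rw [drift_eq_diagonal] at hA
  have := filter_mem L _ (hL _ hA) hB (fun x => if x = 0 then 0 else 1)
  convert L.sub_mem hB this using 1
  ext i j
  by_cases h : i = j
  · subst h; simp [diagPart]
  · have h1 : -E i - -E j ≠ 0 := by
      intro h2; exact hE i j h (by linarith)
    simp only [diagPart, diagonal_apply_ne _ h, Matrix.sub_apply, of_apply,
      pow_eq_zero_iff two_ne_zero, if_neg h1, one_smul, sub_self]

lemma partAlong_apply_ne_zero {S : Set (Fin N × Fin N)} {M : Matrix (Fin N) (Fin N) ℂ}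
    {a b : Fin N} (h : partAlong S M a b ≠ 0) : (a, b) ∈ S ∧ M a b ≠ 0 := by
  simp only [partAlong, of_apply] at h
  split_ifs at h with h1
  · exact ⟨h1, h⟩
  · exact absurd rfl h

/-- The roots touched by `M` that are regular for a diagonal element of a Lie algebra containing
`M` have their root spaces in this Lie algebra. -/
lemma rootMatrix_mem_of_partAlong (L : Submodule ℝ (Matrix (Fin N) (Fin N) ℂ))
    (hL : ∀ X ∈ L, ∀ Y ∈ L, X * Y - Y * X ∈ L) (d : Fin N → ℝ)
    (hD : diagonal (fun i => Complex.I * (d i : ℂ)) ∈ L)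
    {M : Matrix (Fin N) (Fin N) ℂ} (hM : M ∈ L) (hskew : Mᴴ = -M) {Γ : Set (Fin N × Fin N)}
    (hΓ : ∀ j k, j ≠ k → M j k ≠ 0 → (j, k) ∈ Γ) {a b : Fin N} (hab : a ≠ b)
    (h : partAlong (Γ ∩ regularRoots Γ (diagonal fun i => Complex.I * (d i : ℂ))) M a b ≠ 0)
    (z : ℂ) : rootMatrix a b z ∈ L := by
  obtain ⟨⟨-, -, hreg⟩, hne⟩ := partAlong_apply_ne_zero h
  refine rootMatrix_mem_of_regular L d (hL _ hD) hM (eq_neg_star_of_conjTranspose_eq_neg hskew)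
    hab hne (fun j k hjk hMjk hp heq => hreg _ (hΓ j k hjk hMjk) hp ?_) z
  rw [rootValue_diagonal, rootValue_diagonal, heq]

lemma bracketC_drift_apply (E : Fin N → ℝ) (B : Matrix (Fin N) (Fin N) ℂ) (i j : Fin N) :
    bracketC (drift E) B i j = -Complex.I * (E i - E j) * B i j := by
  rw [drift_eq_diagonal, bracketC, Matrix.sub_apply, diagonal_mul, mul_diagonal]
  push_cast
  ring

lemma bracketC_conjTranspose {A B : Matrix (Fin N) (Fin N) ℂ} (hA : Aᴴ = -A) (hB : Bᴴ = -B) :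
    (bracketC A B)ᴴ = -bracketC A B := by
  simp [bracketC, conjTranspose_mul, hA, hB]

lemma drift_conjTranspose (E : Fin N → ℝ) : (drift E)ᴴ = -drift E := by
  rw [drift_eq_diagonal, diagonal_conjTranspose, diagonal_neg]
  congr 1
  ext i
  simp

lemma graph_adj_cases {M : Matrix (Fin N) (Fin N) ℂ} {P : Fin N → Fin N → Prop}
    (hP : ∀ a b, P a b → P b a) (h : ∀ a b, a ≠ b → M a b ≠ 0 → P a b) {a b : Fin N}
    (hab : (graph M).Adj a b) : P a b := by
  rw [graph, SimpleGraph.fromRel_adj] at hab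
  obtain ⟨hne, h1 | h1⟩ := hab
  · exact h a b hne h1
  · exact hP b a (h b a hne.symm h1)

/-- The Lie algebra rank condition: under the graph condition, a real Lie algebra that contains
`A` and `B` contains `su(N)`. -/
lemma mem_of_connected_regularPart (L : Submodule ℝ (Matrix (Fin N) (Fin N) ℂ))
    (hL : ∀ X ∈ L, ∀ Y ∈ L, X * Y - Y * X ∈ L) {E : Fin N → ℝ}
    (hE : ∀ i j : Fin N, i ≠ j → E i ≠ E j) {B : Matrix (Fin N) (Fin N) ℂ} (hBskew : Bᴴ = -B)
    (hA : drift E ∈ L) (hB : B ∈ L)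
    (hG : (graph (regularPartB (touchedRoots B) (drift E) B) ⊔
      graph (regularPartC (touchedRoots B) (drift E) B)).Connected)
    {M : Matrix (Fin N) (Fin N) ℂ} (hM : Mᴴ = -M) (htr : M.trace = 0) : M ∈ L := by
  have hsymm : ∀ a b, (∀ z, rootMatrix a b z ∈ L) → ∀ z, rootMatrix b a z ∈ L := by
    intro a b h z
    rw [rootMatrix_swap]; exact h _
  refine mem_of_connected_rootMatrix L hL _ hG (fun a b hab => ?_) hM htr
  rw [SimpleGraph.sup_adj] at hab
  rcases hab with hab | hab
  · refine graph_adj_cases (P := fun a b => ∀ z, rootMatrix a b z ∈ L) hsymm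
      (fun a b hne h => ?_) hab
    refine rootMatrix_mem_of_partAlong L hL (fun i => -E i) ?_ hB hBskew (Γ := touchedRoots B)
      (fun j k hjk hjk' => ⟨hjk, hjk'⟩) hne ?_
    · rwa [drift_eq_diagonal] at hA
    · rw [← drift_eq_diagonal]
      simpa [regularPartB, diagPart, diagonal_apply_ne _ hne] using h
  · refine graph_adj_cases (P := fun a b => ∀ z, rootMatrix a b z ∈ L) hsymm
      (fun a b hne h => ?_) hab
    -- Here B₀ is the diagonal element and C the filtered matrix. Each entry of C is a multiple of
    -- that of `B`, so its support stays in Γ.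
    refine rootMatrix_mem_of_partAlong L hL (fun i => (B i i).im) ?_ (hL _ hA _ hB)
      (bracketC_conjTranspose (drift_conjTranspose E) hBskew) (Γ := touchedRoots B)
      (fun j k hjk hjk' => ⟨hjk, fun h0 => hjk' ?_⟩) hne ?_
    · rw [← diagPart_eq_diagonal hBskew]
      exact diagPart_mem L hL hE hA hB
    · have := bracketC_drift_apply E B j k
      simp only at h0
      rwa [h0, mul_zero] at this
    · rw [← diagPart_eq_diagonal hBskew]
      exact h

/-- Regularity among fewer roots is a weaker condition, so that it yields larger graphs. -/
lemma graph_regularPart_mono (A B : Matrix (Fin N) (Fin N) ℂ) :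
    graph (regularPartB (roots N) A B) ⊔ graph (regularPartC (roots N) A B) ≤
      graph (regularPartB (touchedRoots B) A B) ⊔ graph (regularPartC (touchedRoots B) A B) := by
  have hpart : ∀ (H M : Matrix (Fin N) (Fin N) ℂ) (a b : Fin N),
      partAlong (touchedRoots B ∩ regularRoots (roots N) H) M a b ≠ 0 →
      partAlong (touchedRoots B ∩ regularRoots (touchedRoots B) H) M a b ≠ 0 := by
    intro H M a b h
    obtain ⟨⟨h1, h2⟩, h3⟩ := partAlong_apply_ne_zero h
    have h4 : (a, b) ∈ touchedRoots B ∩ regularRoots (touchedRoots B) H :=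
      ⟨h1, h1, fun q hq => h2.2 q hq.1⟩
    simpa [partAlong, h4] using h3
  have hmono : ∀ M M' : Matrix (Fin N) (Fin N) ℂ, (∀ a b, a ≠ b → M a b ≠ 0 → M' a b ≠ 0) →
      graph M ≤ graph M' := by
    intro M M' h a b hab
    simp only [graph, SimpleGraph.fromRel_adj] at hab ⊢
    exact ⟨hab.1, hab.2.imp (h a b hab.1) (h b a hab.1.symm)⟩
  refine sup_le_sup (hmono _ _ fun a b hne h => ?_) (hmono _ _ fun a b _ h => hpart _ _ _ _ h)
  simp only [regularPartB, Matrix.add_apply, diagPart, diagonal_apply_ne _ hne, zero_add] at h ⊢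
  exact hpart _ _ _ _ h

/-! ### The exponential map of SU(N) -/

lemma exp_I_smul_eq_conj (V : unitaryGroup (Fin N) ℂ) (d : Fin N → ℝ) :
    NormedSpace.exp (Complex.I •
      ((V : Matrix (Fin N) (Fin N) ℂ) * diagonal (fun j => (d j : ℂ)) *
        star (V : Matrix (Fin N) (Fin N) ℂ))) =
      (V : Matrix (Fin N) (Fin N) ℂ) * diagonal (fun j => Complex.exp (Complex.I * d j)) *
        star (V : Matrix (Fin N) (Fin N) ℂ) := by
  have h : Complex.I • ((V : Matrix (Fin N) (Fin N) ℂ) * diagonal (fun j => (d j : ℂ)) *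
      star (V : Matrix (Fin N) (Fin N) ℂ)) =
      ((Unitary.toUnits V : (Matrix (Fin N) (Fin N) ℂ)ˣ) : Matrix (Fin N) (Fin N) ℂ) * (Complex.I • diagonal (fun j => (d j : ℂ))) *
        (((Unitary.toUnits V)⁻¹ : (Matrix (Fin N) (Fin N) ℂ)ˣ) : Matrix (Fin N) (Fin N) ℂ) := by
    simp
  rw [h, Matrix.exp_units_conj, ← diagonal_smul, Matrix.exp_diagonal]
  have : NormedSpace.exp (Complex.I • fun j => (d j : ℂ)) =
      fun j => Complex.exp (Complex.I * d j) := by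
    ext j
    rw [Pi.coe_exp, Complex.exp_eq_exp_ℂ]
    rfl
  rw [this]
  simp

lemma det_conj (V : unitaryGroup (Fin N) ℂ) (D : Matrix (Fin N) (Fin N) ℂ) :
    ((V : Matrix (Fin N) (Fin N) ℂ) * D * star (V : Matrix (Fin N) (Fin N) ℂ)).det = D.det := by
  rw [det_mul_right_comm, Unitary.mul_star_self_of_mem V.2, one_mul]

lemma trace_conj (V : unitaryGroup (Fin N) ℂ) (D : Matrix (Fin N) (Fin N) ℂ) :
    ((V : Matrix (Fin N) (Fin N) ℂ) * D * star (V : Matrix (Fin N) (Fin N) ℂ)).trace =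
      D.trace := by
  rw [trace_mul_cycle, Unitary.star_mul_self_of_mem V.2, one_mul]

lemma exists_unitary_conj {H : Matrix (Fin N) (Fin N) ℂ} (hH : H.IsHermitian) :
    ∃ (V : unitaryGroup (Fin N) ℂ) (d : Fin N → ℝ),
      H = (V : Matrix (Fin N) (Fin N) ℂ) * diagonal (fun j => (d j : ℂ)) *
        star (V : Matrix (Fin N) (Fin N) ℂ) := by
  refine ⟨hH.eigenvectorUnitary, hH.eigenvalues, ?_⟩
  conv_lhs => rw [hH.spectral_theorem, Unitary.conjStarAlgAut_apply]
  rfl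

lemma exp_mem_specialUnitaryGroup {M : Matrix (Fin N) (Fin N) ℂ} (hM : Mᴴ = -M)
    (htr : M.trace = 0) : NormedSpace.exp M ∈ specialUnitaryGroup (Fin N) ℂ := by
  rw [mem_specialUnitaryGroup_iff]
  let +nondep : NormedAlgebra ℚ (Matrix (Fin N) (Fin N) ℂ) := .restrictScalars ℚ ℂ _
  refine ⟨NormedSpace.exp_mem_unitary_of_mem_skewAdjoint hM, ?_⟩
  have hH : (-Complex.I • M).IsHermitian := by
    simp [IsHermitian, conjTranspose_smul, hM]
  obtain ⟨V, d, h⟩ := exists_unitary_conj hH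
  have h1 : M = Complex.I • (-Complex.I • M) := by simp [smul_smul]
  have h2 : ∑ j, (d j : ℂ) = 0 := by
    have := congrArg trace h
    rw [trace_conj, trace_smul, htr, smul_zero, trace_diagonal] at this
    exact this.symm
  rw [h1, h, exp_I_smul_eq_conj, det_conj, det_diagonal, ← Complex.exp_sum, ← Finset.mul_sum, h2,
    mul_zero, Complex.exp_zero]

/-- The logarithm is `Complex.arg` applied by functional calculus: its discontinuity is harmless on
a finite spectrum, and exp(i arg y) = y on the unit circle. -/
lemma exists_isHermitian_exp {Y : Matrix (Fin N) (Fin N) ℂ} (hY : Y ∈ unitaryGroup (Fin N) ℂ) :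
    ∃ H : Matrix (Fin N) (Fin N) ℂ, H.IsHermitian ∧ NormedSpace.exp (Complex.I • H) = Y := by
  have hn : IsStarNormal Y := ⟨by
    rw [commute_iff_eq, Unitary.star_mul_self_of_mem hY, Unitary.mul_star_self_of_mem hY]⟩
  refine ⟨cfc (fun z : ℂ => (z.arg : ℂ)) Y, IsSelfAdjoint.cfc_arg Y, ?_⟩
  have hfin : (spectrum ℂ Y).Finite := Matrix.finite_spectrum Y
  have hc1 : ContinuousOn (fun z : ℂ => (z.arg : ℂ)) (spectrum ℂ Y) := hfin.continuousOn _
  rw [← CFC.exp_eq_normedSpace_exp (𝕜 := ℂ), ← cfc_const_mul .., ← cfc_comp' ..]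
  conv_rhs => rw [← cfc_id' ℂ Y]
  refine cfc_congr fun y hy ↦ ?_
  have hy₁ : ‖y‖ = 1 := spectrum.norm_eq_one_of_unitary hY hy
  have := Complex.norm_mul_exp_arg_mul_I y
  rw [hy₁, Complex.ofReal_one, one_mul] at this
  rw [← Complex.exp_eq_exp_ℂ, mul_comm, this]

/-- The exponential map of `su(N)` is onto `SU(N)`. -/
lemma exists_exp_eq [Nonempty (Fin N)] {Y : Matrix (Fin N) (Fin N) ℂ}
    (hY : Y ∈ specialUnitaryGroup (Fin N) ℂ) :
    ∃ M : Matrix (Fin N) (Fin N) ℂ, Mᴴ = -M ∧ M.trace = 0 ∧ NormedSpace.exp M = Y := by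
  classical
  rw [mem_specialUnitaryGroup_iff] at hY
  obtain ⟨H, hH, hexp⟩ := exists_isHermitian_exp hY.1
  obtain ⟨V, d, h⟩ := exists_unitary_conj hH
  rw [h, exp_I_smul_eq_conj] at hexp
  have hdet := hY.2
  rw [← hexp, det_conj, det_diagonal, ← Complex.exp_sum, Complex.exp_eq_one_iff] at hdet
  obtain ⟨n, hn⟩ := hdet
  obtain ⟨o⟩ := ‹Nonempty (Fin N)›
  have hsum : ∑ j, d j = n * (2 * Real.pi) := by
    rw [← Finset.mul_sum, ← Complex.ofReal_sum] at hn
    have h1 : Complex.I * ((∑ j, d j : ℝ) : ℂ) = Complex.I * ((n * (2 * Real.pi) : ℝ) : ℂ) := by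
      rw [hn]; push_cast; ring
    exact Complex.ofReal_injective (mul_left_cancel₀ Complex.I_ne_zero h1)
  -- Determinant 1 only puts the trace of the logarithm in 2πiℤ. Shifting one eigenvalue by a
  -- multiple of 2π makes it zero without changing the exponential.
  let d' : Fin N → ℝ := fun j => d j - if j = o then n * (2 * Real.pi) else 0
  have hd' : ∑ j, d' j = 0 := by simp [d', Finset.sum_sub_distrib, hsum]
  refine ⟨Complex.I • ((V : Matrix (Fin N) (Fin N) ℂ) * diagonal (fun j => (d' j : ℂ)) *
        star (V : Matrix (Fin N) (Fin N) ℂ)), ?_, ?_, ?_⟩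
  · have : star (fun j => (d' j : ℂ)) = fun j => (d' j : ℂ) := by ext j; simp
    simp [conjTranspose_smul, conjTranspose_mul, star_eq_conjTranspose, diagonal_conjTranspose,
      this, mul_assoc]
  · rw [trace_smul, trace_conj, trace_diagonal, ← Complex.ofReal_sum, hd']
    simp
  · rw [exp_I_smul_eq_conj, ← hexp]
    congr 3
    ext j
    by_cases hj : j = o
    · simp only [d', hj, if_true]
      rw [Complex.exp_eq_exp_iff_exists_int]
      exact ⟨-n, by push_cast; ring⟩
    · simp [d', hj]

/-! ### The reachable semigroup -/

lemma one_mem_reachableSet (A B : Matrix (Fin N) (Fin N) ℂ) : 1 ∈ reachableSet A B := by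
  refine ⟨one_mem _, 0, le_rfl, 0, ⟨∅, by simp⟩, 1, ⟨?_, rfl, fun _ _ => one_mem _, ∅, by simp⟩, rfl⟩
  exact continuousOn_const

lemma exp_mem_reachableSet {A B : Matrix (Fin N) (Fin N) ℂ} (u : ℝ)
    (hskew : (A + u • B)ᴴ = -(A + u • B)) (htr : (A + u • B).trace = 0) {t : ℝ} (ht : 0 ≤ t) :
    NormedSpace.exp (t • (A + u • B)) ∈ reachableSet A B := by
  have hmem : ∀ s : ℝ, NormedSpace.exp (s • (A + u • B)) ∈ specialUnitaryGroup (Fin N) ℂ := by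
    intro s
    refine exp_mem_specialUnitaryGroup ?_ ?_
    · rw [conjTranspose_smul, hskew, star_trivial, smul_neg]
    · rw [trace_smul, htr, smul_zero]
  have hder : ∀ s : ℝ, HasDerivAt (fun s : ℝ => NormedSpace.exp (s • (A + u • B)))
      ((A + u • B) * NormedSpace.exp (s • (A + u • B))) s := fun s =>
    hasDerivAt_exp_smul_const' (A + u • B) s
  refine ⟨hmem t, t, ht, fun _ => u, ⟨∅, by simp⟩, fun s => NormedSpace.exp (s • (A + u • B)),
    ⟨fun s _ => (hder s).continuousAt.continuousWithinAt, by simp, fun s _ => hmem s, ∅,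
      fun s _ _ => hder s⟩, rfl⟩

/-- The system is right-invariant, so the trajectory to `Z`, delayed and multiplied on the right by
`Y`, continues the trajectory to `Y`. The junction time joins the exceptional sets. -/
lemma mul_mem_reachableSet {A B Y Z : Matrix (Fin N) (Fin N) ℂ} (hZ : Z ∈ reachableSet A B)
    (hY : Y ∈ reachableSet A B) : Z * Y ∈ reachableSet A B := by
  classical
  obtain ⟨hYm, t₁, ht₁, u₁, ⟨F₁, hF₁⟩, X₁, ⟨hc₁, h0₁, hm₁, G₁, hG₁⟩, rfl⟩ := hY
  obtain ⟨hZm, t₂, ht₂, u₂, ⟨F₂, hF₂⟩, X₂, ⟨hc₂, h0₂, hm₂, G₂, hG₂⟩, rfl⟩ := hZ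
  set X : ℝ → Matrix (Fin N) (Fin N) ℂ := fun s =>
    if s ≤ t₁ then X₁ s else X₂ (s - t₁) * X₁ t₁ with hX
  have hXle : ∀ s, s ≤ t₁ → X s = X₁ s := fun s hs => by simp [hX, hs]
  have hXge : ∀ s, t₁ ≤ s → X s = X₂ (s - t₁) * X₁ t₁ := by
    intro s hs
    rcases hs.eq_or_lt with rfl | hs
    · simp [hX, h0₂]
    · simp [hX, not_le.2 hs]
  have hshift : ∀ s, Filter.Tendsto (fun s' => s' - t₁) (𝓝 s) (𝓝 (s - t₁)) := fun s =>
    (continuous_id.sub continuous_const).tendsto s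
  refine ⟨mul_mem hZm hYm, t₁ + t₂, add_nonneg ht₁ ht₂,
    fun s => if s < t₁ then u₁ s else u₂ (s - t₁),
    ⟨F₁ ∪ {t₁} ∪ F₂.image (· + t₁), fun s hs hsF => ?_⟩, X, ⟨?_, ?_, ?_, G₁ ∪ {t₁} ∪ G₂.image (· + t₁),
    fun s hs hsF => ?_⟩, ?_⟩
  · simp only [Finset.mem_union, Finset.mem_singleton, Finset.mem_image, not_or, not_exists,
      not_and] at hsF
    obtain ⟨⟨h1, h2⟩, h3⟩ := hsF
    rcases lt_or_gt_of_ne h2 with hlt | hgt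
    · filter_upwards [hF₁ s ⟨hs.1, hlt⟩ h1, Iio_mem_nhds hlt] with s' h4 h5
      simp only [Set.mem_Iio] at h5
      simp [hlt, h5, h4]
    · have h6 := hF₂ (s - t₁) ⟨by linarith, by linarith [hs.2]⟩ (fun h => h3 _ h (by ring))
      filter_upwards [(hshift s).eventually h6, Ioi_mem_nhds hgt] with s' h4 h5
      simp only [Set.mem_Ioi] at h5
      simp [hgt.le.not_gt, h5.le.not_gt, h4]
  · have hunion : Set.Icc 0 (t₁ + t₂) = Set.Icc 0 t₁ ∪ Set.Icc t₁ (t₁ + t₂) :=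
      (Set.Icc_union_Icc_eq_Icc ht₁ (by linarith)).symm
    rw [hunion]
    refine ContinuousOn.union_of_isClosed ?_ ?_ isClosed_Icc isClosed_Icc
    · exact hc₁.congr fun s hs => hXle s hs.2
    · refine ContinuousOn.congr (f := fun s => X₂ (s - t₁) * X₁ t₁) ?_ fun s hs => hXge s hs.1
      refine ContinuousOn.mul (hc₂.comp (by fun_prop) ?_) continuousOn_const
      intro s hs
      exact ⟨by linarith [hs.1], by linarith [hs.2]⟩
  · rw [hXle 0 ht₁, h0₁]
  · intro s hs
    rcases le_total s t₁ with h | h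
    · rw [hXle s h]; exact hm₁ s ⟨hs.1, h⟩
    · rw [hXge s h]
      exact mul_mem (hm₂ _ ⟨by linarith, by linarith [hs.2]⟩) hYm
  · simp only [Finset.mem_union, Finset.mem_singleton, Finset.mem_image, not_or, not_exists,
      not_and] at hsF
    obtain ⟨⟨h1, h2⟩, h3⟩ := hsF
    rcases lt_or_gt_of_ne h2 with hlt | hgt
    · simp only [hlt, if_true, hXle s hlt.le]
      refine HasDerivAt.congr_of_eventuallyEq (hG₁ s ⟨hs.1, hlt⟩ h1) ?_
      filter_upwards [Iio_mem_nhds hlt] with s' h5 using hXle s' (le_of_lt h5)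
    · simp only [hgt.le.not_gt, if_false, hXge s hgt.le]
      have h6 : HasDerivAt X₂ _ (s - t₁) :=
        hG₂ (s - t₁) ⟨by linarith, by linarith [hs.2]⟩ (fun h => h3 _ h (by ring))
      have h7 := (h6.comp_sub_const s t₁).mul_const (X₁ t₁)
      rw [mul_assoc] at h7
      refine HasDerivAt.congr_of_eventuallyEq h7 ?_
      filter_upwards [Ioi_mem_nhds hgt] with s' h5 using hXge s' (le_of_lt h5)
  · rw [hXge _ (by linarith), add_sub_cancel_left]

/-- The reachable set is a semigroup. -/
def reachableSubmonoid (A B : Matrix (Fin N) (Fin N) ℂ) :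
    Submonoid (Matrix (Fin N) (Fin N) ℂ) where
  carrier := reachableSet A B
  mul_mem' := mul_mem_reachableSet
  one_mem' := one_mem_reachableSet A B

/-! ### Closures of semigroups in SU(N) -/

lemma mul_star_self_of_mem_SU {g : Matrix (Fin N) (Fin N) ℂ}
    (hg : g ∈ specialUnitaryGroup (Fin N) ℂ) : g * star g = 1 :=
  Unitary.mul_star_self_of_mem (specialUnitaryGroup_le_unitaryGroup hg)

lemma star_mul_self_of_mem_SU {g : Matrix (Fin N) (Fin N) ℂ}
    (hg : g ∈ specialUnitaryGroup (Fin N) ℂ) : star g * g = 1 :=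
  Unitary.star_mul_self_of_mem (specialUnitaryGroup_le_unitaryGroup hg)

lemma star_mem_SU {g : Matrix (Fin N) (Fin N) ℂ}
    (hg : g ∈ specialUnitaryGroup (Fin N) ℂ) : star g ∈ specialUnitaryGroup (Fin N) ℂ :=
  (star (⟨g, hg⟩ : specialUnitaryGroup (Fin N) ℂ)).2

lemma isClosed_specialUnitaryGroup :
    IsClosed (specialUnitaryGroup (Fin N) ℂ : Set (Matrix (Fin N) (Fin N) ℂ)) := by
  have h : (specialUnitaryGroup (Fin N) ℂ : Set (Matrix (Fin N) (Fin N) ℂ)) =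
      (unitary (Matrix (Fin N) (Fin N) ℂ) : Set _) ∩ {g | g.det = 1} := by
    ext g
    exact mem_specialUnitaryGroup_iff
  rw [h]
  exact isClosed_unitary.inter (isClosed_eq continuous_id.matrix_det continuous_const)

lemma topologicalClosure_le_SU {S : Submonoid (Matrix (Fin N) (Fin N) ℂ)}
    (hS : S ≤ specialUnitaryGroup (Fin N) ℂ) :
    S.topologicalClosure ≤ specialUnitaryGroup (Fin N) ℂ :=
  S.topologicalClosure_minimal hS isClosed_specialUnitaryGroup

/-- The closure of a semigroup in `SU(N)` is a group. -/
lemma star_mem_topologicalClosure {S : Submonoid (Matrix (Fin N) (Fin N) ℂ)}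
    (hS : S ≤ specialUnitaryGroup (Fin N) ℂ) {g : Matrix (Fin N) (Fin N) ℂ}
    (hg : g ∈ S.topologicalClosure) : star g ∈ S.topologicalClosure := by
  have hgSU := topologicalClosure_le_SU hS hg
  have hu : ∀ n : ℕ, g ^ n ∈ unitary (Matrix (Fin N) (Fin N) ℂ) := fun n =>
    specialUnitaryGroup_le_unitaryGroup (pow_mem hgSU n)
  have hbd : ∀ n : ℕ, g ^ n ∈ Metric.closedBall (0 : Matrix (Fin N) (Fin N) ℂ) ‖(1 : Matrix (Fin N) (Fin N) ℂ)‖ := by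
    intro n
    rw [mem_closedBall_zero_iff, ← mul_one (g ^ n), CStarRing.norm_mem_unitary_mul _ (hu n)]
  obtain ⟨a, -, φ, hφ, hlim⟩ := tendsto_subseq_of_bounded Metric.isBounded_closedBall hbd
  have hcl : IsClosed (S.topologicalClosure : Set (Matrix (Fin N) (Fin N) ℂ)) :=
    S.isClosed_topologicalClosure
  rw [← SetLike.mem_coe, ← hcl.closure_eq, Metric.mem_closure_iff]
  intro ε hε
  obtain ⟨n, hn⟩ := Metric.cauchySeq_iff'.1 hlim.cauchySeq ε hε
  have hn := hn (n + 1) (Nat.le_succ n)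
  have hlt : φ n < φ (n + 1) := hφ (Nat.lt_succ_self n)
  -- Two powers of g being close, their quotient g^(m + 1) is close to 1, so g^m is close to the
  -- inverse of g.
  obtain ⟨m, hm⟩ : ∃ m, φ (n + 1) = φ n + 1 + m := ⟨φ (n + 1) - (φ n + 1), by omega⟩
  refine ⟨g ^ m, pow_mem hg m, ?_⟩
  rw [dist_comm, dist_eq_norm, ← CStarRing.norm_mem_unitary_mul _ (hu (φ n + 1)), mul_sub,
    ← pow_add, ← hm, pow_succ, mul_assoc, mul_star_self_of_mem_SU hgSU, mul_one, ← dist_eq_norm]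
  exact hn

/-! ### Spanning su(N) by conjugates -/

/-- Right difference quotients suffice, which matters because the semigroup contains exp(tX) only
for t ≥ 0. -/
lemma hasDerivAt_mem_submodule {W : Submodule ℝ (Matrix (Fin N) (Fin N) ℂ)}
    {f : ℝ → Matrix (Fin N) (Fin N) ℂ} {f' : Matrix (Fin N) (Fin N) ℂ} (hf : HasDerivAt f f' 0)
    (hW : ∀ t, 0 ≤ t → f t ∈ W) : f' ∈ W := by
  have h1 : Filter.Tendsto (slope f 0) (𝓝[>] 0) (𝓝 f') :=
    (hasDerivAt_iff_tendsto_slope.1 hf).mono_left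
      (nhdsWithin_mono _ fun x (hx : 0 < x) => ne_of_gt hx)
  refine W.closed_of_finiteDimensional.mem_of_tendsto h1 ?_
  filter_upwards [self_mem_nhdsWithin] with t ht
  rw [slope_def_module]
  exact W.smul_mem _ (W.sub_mem (hW t (le_of_lt ht)) (hW 0 le_rfl))

/-- The span of the conjugates, by a semigroup containing `exp (t X)` for `t ≥ 0`, of given
matrices is invariant under the commutator with `X`. -/
lemma commutator_mem_span_conj {H : Submonoid (Matrix (Fin N) (Fin N) ℂ)}
    {𝒳 : Set (Matrix (Fin N) (Fin N) ℂ)} {X : Matrix (Fin N) (Fin N) ℂ} (hX : Xᴴ = -X)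
    (hexp : ∀ t : ℝ, 0 ≤ t → NormedSpace.exp (t • X) ∈ H)
    {w : Matrix (Fin N) (Fin N) ℂ}
    (hw : w ∈ Submodule.span ℝ {M | ∃ g ∈ H, ∃ Z ∈ 𝒳, M = g * Z * star g}) :
    X * w - w * X ∈ Submodule.span ℝ {M | ∃ g ∈ H, ∃ Z ∈ 𝒳, M = g * Z * star g} := by
  have hconj : ∀ h ∈ H, h * w * star h ∈
      Submodule.span ℝ {M | ∃ g ∈ H, ∃ Z ∈ 𝒳, M = g * Z * star g} := by
    intro h hh
    induction hw using Submodule.span_induction with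
    | mem x hx =>
      obtain ⟨g, hg, Z, hZ, rfl⟩ := hx
      exact Submodule.subset_span ⟨h * g, mul_mem hh hg, Z, hZ, by simp only [star_mul, mul_assoc]⟩
    | zero => simp
    | add x y _ _ hx hy => rw [mul_add, add_mul]; exact Submodule.add_mem _ hx hy
    | smul r x _ hx =>
      rw [mul_smul_comm, smul_mul_assoc]; exact Submodule.smul_mem _ r hx
  have hstar : ∀ t : ℝ, star (NormedSpace.exp (t • X)) = NormedSpace.exp (t • (-X)) := by
    intro t
    rw [NormedSpace.star_exp, star_smul, star_trivial, star_eq_conjTranspose, hX]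
  have hd : HasDerivAt (fun t : ℝ => NormedSpace.exp (t • X) * w * NormedSpace.exp (t • (-X)))
      (X * w - w * X) 0 := by
    have h1 := ((hasDerivAt_exp_smul_const X (0 : ℝ)).mul_const w).mul
      (hasDerivAt_exp_smul_const (-X) (0 : ℝ))
    refine HasDerivAt.congr_deriv h1 ?_
    simp [sub_eq_add_neg]
  refine hasDerivAt_mem_submodule hd fun t ht => ?_
  rw [← hstar]
  exact hconj _ (hexp t ht)

/-- If a set of skew-Hermitian matrices generates `su(N)` as a Lie algebra, then `su(N)` is
spanned by conjugates of its elements. -/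
lemma mem_span_conj {H : Submonoid (Matrix (Fin N) (Fin N) ℂ)}
    {𝒳 : Set (Matrix (Fin N) (Fin N) ℂ)} (hX : ∀ X ∈ 𝒳, Xᴴ = -X)
    (hexp : ∀ X ∈ 𝒳, ∀ t : ℝ, 0 ≤ t → NormedSpace.exp (t • X) ∈ H)
    {M : Matrix (Fin N) (Fin N) ℂ}
    (hM : ∀ L : Submodule ℝ (Matrix (Fin N) (Fin N) ℂ),
      (∀ X ∈ L, ∀ Y ∈ L, X * Y - Y * X ∈ L) → 𝒳 ⊆ L → M ∈ L) :
    M ∈ Submodule.span ℝ {M | ∃ g ∈ H, ∃ Z ∈ 𝒳, M = g * Z * star g} := by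
  set W := Submodule.span ℝ {M | ∃ g ∈ H, ∃ Z ∈ 𝒳, M = g * Z * star g} with hW
  -- The elements of `W` that normalize `W` form a Lie algebra by the Jacobi identity. It contains
  -- `𝒳`, hence `M`.
  let L : Submodule ℝ (Matrix (Fin N) (Fin N) ℂ) :=
    { carrier := {X | X ∈ W ∧ ∀ w ∈ W, X * w - w * X ∈ W}
      add_mem' := fun {X Y} hX hY => ⟨W.add_mem hX.1 hY.1, fun w hw => by
        convert W.add_mem (hX.2 w hw) (hY.2 w hw) using 1
        noncomm_ring⟩
      zero_mem' := ⟨W.zero_mem, fun w _ => by simp⟩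
      smul_mem' := fun r X hX => ⟨W.smul_mem r hX.1, fun w hw => by
        convert W.smul_mem r (hX.2 w hw) using 1
        rw [smul_mul_assoc, mul_smul_comm, smul_sub]⟩ }
  refine (hM L ?_ ?_).1
  · rintro X ⟨-, hX2⟩ Y ⟨hY1, hY2⟩
    refine ⟨hX2 _ hY1, fun w hw => ?_⟩
    convert W.sub_mem (hX2 _ (hY2 w hw)) (hY2 _ (hX2 w hw)) using 1
    noncomm_ring
  · intro X hX𝒳
    exact ⟨Submodule.subset_span ⟨1, one_mem _, X, hX𝒳, by simp⟩,
      fun w hw => commutator_mem_span_conj (hX X hX𝒳) (hexp X hX𝒳) hw⟩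

/-! ### Velocities of families in a semigroup -/

/-- Some smooth family in `S` has, at one of its points `Ψ τ`, all the directions `M * Ψ τ`,
`M ∈ V`, among its velocities. -/
def IsVelocitySpace (S : Submonoid (Matrix (Fin N) (Fin N) ℂ))
    (V : Submodule ℝ (Matrix (Fin N) (Fin N) ℂ)) : Prop :=
  ∃ (F : Type) (_ : NormedAddCommGroup F) (_ : NormedSpace ℝ F) (_ : CompleteSpace F)
    (Ψ : F → Matrix (Fin N) (Fin N) ℂ) (Ψ' : F →L[ℝ] Matrix (Fin N) (Fin N) ℂ) (τ : F),
    HasStrictFDerivAt Ψ Ψ' τ ∧ (∀ᶠ t in 𝓝 τ, Ψ t ∈ S) ∧ ∀ M ∈ V, ∃ δ, Ψ' δ = M * Ψ τ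

lemma isVelocitySpace_bot (S : Submonoid (Matrix (Fin N) (Fin N) ℂ)) : IsVelocitySpace S ⊥ := by
  refine ⟨ℝ, inferInstance, inferInstance, inferInstance, fun _ => 1, 0, 0,
    hasStrictFDerivAt_const _ _, Filter.Eventually.of_forall fun _ => one_mem S, fun M hM => ⟨0, ?_⟩⟩
  rw [(Submodule.mem_bot ℝ).1 hM]
  simp

/-- Extending the family to Ψ(p) r exp(sX) keeps the old velocities, relative to the new base point,
and adds g X g* with g = Ψ(τ) r. Choosing r in `S` near Ψ(τ)* h brings g close to h, so the new
direction stays outside the closed subspace `V`. -/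
lemma IsVelocitySpace.exists_gt {S : Submonoid (Matrix (Fin N) (Fin N) ℂ)}
    (hS : S ≤ specialUnitaryGroup (Fin N) ℂ) {V : Submodule ℝ (Matrix (Fin N) (Fin N) ℂ)}
    (hV : IsVelocitySpace S V) {X : Matrix (Fin N) (Fin N) ℂ}
    (hexp : ∀ t : ℝ, 0 ≤ t → NormedSpace.exp (t • X) ∈ S) {h : Matrix (Fin N) (Fin N) ℂ}
    (hh : h ∈ S.topologicalClosure) (hhV : h * X * star h ∉ V) :
    ∃ V', V < V' ∧ IsVelocitySpace S V' := by
  obtain ⟨F, _, _, _, Ψ, Ψ', τ, hΨ, hΨS, hΨV⟩ := hV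
  have hτ : Ψ τ ∈ S := hΨS.self_of_nhds
  obtain ⟨r, hrS, hr⟩ : ∃ r ∈ S, Ψ τ * r * X * star (Ψ τ * r) ∉ V := by
    have hcont : Continuous fun r => Ψ τ * r * X * star (Ψ τ * r) := by fun_prop
    have hopen : IsOpen {r | Ψ τ * r * X * star (Ψ τ * r) ∉ V} :=
      V.closed_of_finiteDimensional.isOpen_compl.preimage hcont
    have hmem : star (Ψ τ) * h ∈ S.topologicalClosure :=
      mul_mem (star_mem_topologicalClosure hS (S.le_topologicalClosure hτ)) hh
    obtain ⟨r, hr1, hr2⟩ := mem_closure_iff.1 hmem _ hopen (by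
      rw [Set.mem_ofPred_eq, ← mul_assoc, mul_star_self_of_mem_SU (hS hτ), one_mul]
      exact hhV)
    exact ⟨r, hr2, hr1⟩
  set g := Ψ τ * r with hg
  have hgS : g ∈ S := mul_mem hτ hrS
  -- The base time is s = 1, not 0, so that nearby times are still positive and the family stays in
  -- `S`.
  refine ⟨V ⊔ Submodule.span ℝ {g * X * star g}, ?_, F × ℝ, inferInstance, inferInstance,
    inferInstance, (fun p => Ψ p.1 * r) * (fun p => NormedSpace.exp (p.2 • X)), ?_⟩
  · refine lt_of_le_of_ne le_sup_left fun heq => hr ?_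
    rw [heq]
    exact Submodule.mem_sup_right (Submodule.mem_span_singleton_self _)
  · have h0 : HasStrictFDerivAt (fun p : F × ℝ => NormedSpace.exp (p.2 • X)) _ (τ, (1 : ℝ)) :=
      HasStrictFDerivAt.comp (g := fun s : ℝ => NormedSpace.exp (s • X)) (τ, (1 : ℝ))
        (hasStrictDerivAt_exp_smul_const' X (1 : ℝ)).hasStrictFDerivAt hasStrictFDerivAt_snd
    have h1 := ((hΨ.comp (τ, (1 : ℝ)) hasStrictFDerivAt_fst).mul_const' r).mul' h0
    refine ⟨_, (τ, 1), h1, ?_, ?_⟩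
    · have h2 : ∀ᶠ p : F × ℝ in 𝓝 (τ, 1), Ψ p.1 ∈ S :=
        (continuous_fst.tendsto (τ, (1 : ℝ))).eventually hΨS
      have h3 : ∀ᶠ p : F × ℝ in 𝓝 (τ, 1), 0 < p.2 :=
        (continuous_snd.tendsto (τ, (1 : ℝ))).eventually (lt_mem_nhds one_pos)
      filter_upwards [h2, h3] with p h4 h5
      exact mul_mem (mul_mem h4 hrS) (hexp _ h5.le)
    · intro M hM
      obtain ⟨v, hv, w, hw, rfl⟩ := Submodule.mem_sup.1 hM
      obtain ⟨c, rfl⟩ := Submodule.mem_span_singleton.1 hw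
      obtain ⟨δ, hδ⟩ := hΨV v hv
      refine ⟨(δ, c), ?_⟩
      have h6 : star r * (star (Ψ τ) * (Ψ τ * (r * NormedSpace.exp X))) = NormedSpace.exp X := by
        rw [← mul_assoc (star (Ψ τ)), star_mul_self_of_mem_SU (hS hτ), one_mul, ← mul_assoc,
          star_mul_self_of_mem_SU (hS hrS), one_mul]
      simp [hδ, hg, add_mul, mul_assoc, h6, add_comm]

/-- A maximal velocity space contains all conjugates h X h*, since otherwise it could be enlarged;
these span su(N) by `mem_span_conj`. -/
lemma exists_isVelocitySpace {S : Submonoid (Matrix (Fin N) (Fin N) ℂ)}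
    (hS : S ≤ specialUnitaryGroup (Fin N) ℂ)
    {𝒳 : Set (Matrix (Fin N) (Fin N) ℂ)} (hX : ∀ X ∈ 𝒳, Xᴴ = -X)
    (hexp : ∀ X ∈ 𝒳, ∀ t : ℝ, 0 ≤ t → NormedSpace.exp (t • X) ∈ S)
    (hgen : ∀ L : Submodule ℝ (Matrix (Fin N) (Fin N) ℂ),
      (∀ X ∈ L, ∀ Y ∈ L, X * Y - Y * X ∈ L) → 𝒳 ⊆ L →
      ∀ M : Matrix (Fin N) (Fin N) ℂ, Mᴴ = -M → M.trace = 0 → M ∈ L) :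
    ∃ V, IsVelocitySpace S V ∧
      ∀ M : Matrix (Fin N) (Fin N) ℂ, Mᴴ = -M → M.trace = 0 → M ∈ V := by
  obtain ⟨V, hV⟩ := exists_maximal_of_wellFoundedGT (IsVelocitySpace S)
    ⟨_, isVelocitySpace_bot S⟩
  refine ⟨V, hV.prop, fun M hM htr => ?_⟩
  have hspan := mem_span_conj (H := S.topologicalClosure) hX
    (fun X h t ht => S.le_topologicalClosure (hexp X h t ht)) (fun L h1 h2 => hgen L h1 h2 M hM htr)
  refine Submodule.span_le.2 ?_ hspan
  rintro _ ⟨h, hh, X, hX𝒳, rfl⟩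
  by_contra hnot
  obtain ⟨V', hlt, hV'⟩ := hV.prop.exists_gt hS (hexp X hX𝒳) hh hnot
  exact hV.not_gt hV' hlt

/-! ### Interior points -/

lemma exp_smul_I_smul_one (θ : ℝ) :
    NormedSpace.exp (θ • (Complex.I • (1 : Matrix (Fin N) (Fin N) ℂ))) =
      Complex.exp (Complex.I * θ) • 1 := by
  have h := exp_I_smul_eq_conj (1 : unitaryGroup (Fin N) ℂ) fun _ => θ
  have h1 : ∀ c : ℂ, diagonal (fun _ : Fin N => c) = c • (1 : Matrix (Fin N) (Fin N) ℂ) := by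
    intro c; rw [smul_one_eq_diagonal]
  simp only [OneMemClass.coe_one, h1, one_mul, star_one, mul_one] at h
  rw [← h, smul_comm θ Complex.I]
  rfl

/-- An element of `SU(N)` that is the product of a Hermitian matrix close to `1` and a phase close
to `1` is `1`. -/
lemma eq_one_of_hermitian_mul_phase {P : Matrix (Fin N) (Fin N) ℂ} (hN : 0 < N) (hP : star P = P)
    (hP1 : ‖P‖ < 1) {θ : ℝ} (hθ : |θ| < 1 / N)
    (h : (1 + P) * NormedSpace.exp (θ • (Complex.I • (1 : Matrix (Fin N) (Fin N) ℂ))) ∈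
      specialUnitaryGroup (Fin N) ℂ) :
    (1 + P) * NormedSpace.exp (θ • (Complex.I • (1 : Matrix (Fin N) (Fin N) ℂ))) = 1 := by
  rw [exp_smul_I_smul_one, mul_smul_comm, mul_one] at h ⊢
  have hc : star (Complex.exp (Complex.I * θ)) * Complex.exp (Complex.I * θ) = 1 := by
    rw [RCLike.star_def, Complex.conj_mul', mul_comm, Complex.norm_exp_ofReal_mul_I]
    norm_num
  have h1 := star_mul_self_of_mem_SU h
  rw [star_smul, smul_mul_smul_comm, hc, one_smul, star_add, star_one, hP] at h1
  -- Unitarity reads (1 + P)² = 1; with ‖P‖ < 1 this forces P = 0.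
  have h2 : (2 : ℝ) • P = -(P * P) := by
    rw [two_smul, eq_neg_iff_add_eq_zero, ← sub_eq_zero.2 h1]
    noncomm_ring
  have h3 : P = 0 := by
    have h4 : 2 * ‖P‖ ≤ ‖P‖ * ‖P‖ := by
      have := norm_mul_le P P
      rwa [← norm_neg (P * P), ← h2, norm_smul, Real.norm_ofNat] at this
    by_contra h5
    have h6 : 0 < ‖P‖ := norm_pos_iff.2 h5
    nlinarith
  rw [h3, add_zero] at h ⊢
  have hdet := (mem_specialUnitaryGroup_iff.1 h).2
  rw [det_smul, det_one, mul_one, Fintype.card_fin, ← Complex.exp_nat_mul,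
    Complex.exp_eq_one_iff] at hdet
  obtain ⟨n, hn⟩ := hdet
  have hN' : (0 : ℝ) < N := by exact_mod_cast hN
  have h7 : N * θ = n * (2 * Real.pi) := by
    have h8 : Complex.I * ((N * θ : ℝ) : ℂ) = Complex.I * ((n * (2 * Real.pi) : ℝ) : ℂ) := by
      push_cast; linear_combination hn
    exact Complex.ofReal_injective (mul_left_cancel₀ Complex.I_ne_zero h8)
  -- The determinant e^{iNθ} is 1, while |Nθ| < 1 < 2π leaves only θ = 0.
  have h9 : |(N : ℝ) * θ| < 1 := by
    rw [abs_mul, abs_of_pos hN', mul_comm]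
    exact (lt_div_iff₀ hN').1 hθ
  have h10 : n = 0 := by
    by_contra hn0
    have h11 : (1 : ℝ) ≤ |(n : ℝ)| := by exact_mod_cast Int.one_le_abs hn0
    rw [h7, abs_mul, abs_of_pos Real.two_pi_pos] at h9
    nlinarith [Real.pi_gt_three]
  have h12 : θ = 0 := by
    rw [h10, Int.cast_zero, zero_mul] at h7
    exact (mul_eq_zero.1 h7).resolve_left hN'.ne'
  simp [h12]

/-- The Hermitian and the scalar i ℝ directions complement su(N) in the space of all matrices. -/
lemma exists_skew_add_hermitian (hN : 0 < N) (Z : Matrix (Fin N) (Fin N) ℂ) :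
    ∃ (M K : Matrix (Fin N) (Fin N) ℂ) (θ : ℝ), Mᴴ = -M ∧ M.trace = 0 ∧
      Z = M + (K + star K) + θ • (Complex.I • (1 : Matrix (Fin N) (Fin N) ℂ)) := by
  have hN' : (N : ℂ) ≠ 0 := by exact_mod_cast hN.ne'
  set K₁ := (1 / 2 : ℝ) • (Z - Zᴴ) with hK₁
  have hskew : K₁ᴴ = -K₁ := by
    rw [hK₁, conjTranspose_smul, conjTranspose_sub, conjTranspose_conjTranspose, ← smul_neg,
      neg_sub, star_trivial]
  set c : ℝ := K₁.trace.im with hc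
  have htr : K₁.trace = Complex.I * c := by
    have h1 := congrArg Complex.re (trace_conjTranspose K₁)
    rw [hskew, trace_neg] at h1
    simp only [Complex.neg_re, RCLike.star_def, Complex.conj_re] at h1
    have h2 : K₁.trace.re = 0 := by linarith
    apply Complex.ext <;> simp [h2, hc]
  -- The scalar part carries the trace of the skew part `K₁`; the factor 1/4 compensates for `K +
  -- star K` doubling a Hermitian `K`.
  refine ⟨K₁ - (c / N) • (Complex.I • (1 : Matrix (Fin N) (Fin N) ℂ)), (1 / 4 : ℝ) • (Z + Zᴴ),
    c / N, ?_, ?_, ?_⟩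
  · rw [conjTranspose_sub, hskew, conjTranspose_smul, conjTranspose_smul, conjTranspose_one]
    simp [sub_eq_add_neg, add_comm]
  · rw [trace_sub, htr, trace_smul, trace_smul, trace_one]
    simp only [Fintype.card_fin, smul_eq_mul, Complex.real_smul]
    push_cast
    field_simp
    ring
  · rw [star_smul, star_trivial, star_add, star_eq_conjTranspose, star_eq_conjTranspose,
      conjTranspose_conjTranspose, hK₁]
    module

/-- A semigroup in `SU(N)` with velocity space `su(N)` has interior points. -/
lemma IsVelocitySpace.exists_nhds {S : Submonoid (Matrix (Fin N) (Fin N) ℂ)} (hN : 0 < N)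
    (hS : S ≤ specialUnitaryGroup (Fin N) ℂ) {V : Submodule ℝ (Matrix (Fin N) (Fin N) ℂ)}
    (hV : IsVelocitySpace S V)
    (hsu : ∀ M : Matrix (Fin N) (Fin N) ℂ, Mᴴ = -M → M.trace = 0 → M ∈ V) :
    ∃ Y₀ ∈ S, ∀ᶠ Y in 𝓝 Y₀, Y ∈ specialUnitaryGroup (Fin N) ℂ → Y ∈ S := by
  obtain ⟨F, _, _, _, Ψ, Ψ', τ, hΨ, hΨS, hΨV⟩ := hV
  have hτ : Ψ τ ∈ S := hΨS.self_of_nhds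
  refine ⟨Ψ τ, hτ, ?_⟩
  let J : Matrix (Fin N) (Fin N) ℂ := Complex.I • 1
  let p₀ : F × Matrix (Fin N) (Fin N) ℂ × ℝ := (τ, 0, 0)
  let Λ : Matrix (Fin N) (Fin N) ℂ →L[ℝ] Matrix (Fin N) (Fin N) ℂ :=
    ContinuousLinearMap.id ℝ _ + ((starL' ℝ : Matrix (Fin N) (Fin N) ℂ ≃L[ℝ] Matrix (Fin N) (Fin N) ℂ) :
        Matrix (Fin N) (Fin N) ℂ →L[ℝ] Matrix (Fin N) (Fin N) ℂ)
  have hΛ : ∀ K, Λ K = K + star K := fun K => rfl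
  have h1 : HasStrictFDerivAt (fun p : F × Matrix (Fin N) (Fin N) ℂ × ℝ => Ψ p.1) _ p₀ :=
    HasStrictFDerivAt.comp (g := Ψ) p₀ hΨ hasStrictFDerivAt_fst
  have h2 : HasStrictFDerivAt
      (fun p : F × Matrix (Fin N) (Fin N) ℂ × ℝ => 1 + Λ p.2.1) _ p₀ :=
    ((Λ.comp ((ContinuousLinearMap.fst ℝ (Matrix (Fin N) (Fin N) ℂ) ℝ).comp
      (ContinuousLinearMap.snd ℝ F (Matrix (Fin N) (Fin N) ℂ × ℝ)))).hasStrictFDerivAt).const_add 1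
  have h3 : HasStrictFDerivAt
      (fun p : F × Matrix (Fin N) (Fin N) ℂ × ℝ => NormedSpace.exp (p.2.2 • J)) _ p₀ :=
    HasStrictFDerivAt.comp (g := fun s : ℝ => NormedSpace.exp (s • J)) p₀
      (hasStrictDerivAt_exp_smul_const' J (0 : ℝ)).hasStrictFDerivAt
      ((ContinuousLinearMap.snd ℝ (Matrix (Fin N) (Fin N) ℂ) ℝ).comp
        (ContinuousLinearMap.snd ℝ F (Matrix (Fin N) (Fin N) ℂ × ℝ))).hasStrictFDerivAt
  -- The factors (1 + K + K*) and e^{iθ} supply the directions transversal to SU(N), so the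
  -- derivative is onto all matrices and the map is open at `p₀`.
  have h4 := (h2.mul' h3).mul' h1
  have hmap := h4.map_nhds_eq_of_surj (by
    rw [LinearMap.range_eq_top]
    intro T
    obtain ⟨M, K, θ, hM, htr, hZ⟩ := exists_skew_add_hermitian hN (T * star (Ψ τ))
    obtain ⟨δ, hδ⟩ := hΨV M (hsu M hM htr)
    refine ⟨(δ, K, θ), ?_⟩
    have hT : T = T * star (Ψ τ) * Ψ τ := by
      rw [mul_assoc, star_mul_self_of_mem_SU (hS hτ), mul_one]
    rw [hT, hZ]
    simp [p₀, J, hΛ, hδ, add_mul]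
    abel)
  have hval : ((((fun p : F × Matrix (Fin N) (Fin N) ℂ × ℝ => 1 + Λ p.2.1) *
      fun p : F × Matrix (Fin N) (Fin N) ℂ × ℝ => NormedSpace.exp (p.2.2 • J)) *
      fun p : F × Matrix (Fin N) (Fin N) ℂ × ℝ => Ψ p.1) p₀) = Ψ τ := by
    simp [p₀]
  rw [hval] at hmap
  rw [← hmap, Filter.eventually_map]
  have hN' : (0 : ℝ) < N := by exact_mod_cast hN
  have e1 : ∀ᶠ p : F × Matrix (Fin N) (Fin N) ℂ × ℝ in 𝓝 p₀, Ψ p.1 ∈ S :=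
    (continuous_fst.tendsto p₀).eventually hΨS
  have e2 : ∀ᶠ p : F × Matrix (Fin N) (Fin N) ℂ × ℝ in 𝓝 p₀, ‖Λ p.2.1‖ < 1 := by
    have hc : Continuous fun p : F × Matrix (Fin N) (Fin N) ℂ × ℝ => ‖Λ p.2.1‖ := by fun_prop
    exact hc.continuousAt.eventually_lt_const (by simp [p₀])
  have e3 : ∀ᶠ p : F × Matrix (Fin N) (Fin N) ℂ × ℝ in 𝓝 p₀, |p.2.2| < 1 / N := by
    have hc : Continuous fun p : F × Matrix (Fin N) (Fin N) ℂ × ℝ => |p.2.2| := by fun_prop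
    exact hc.continuousAt.eventually_lt_const (by simp [p₀, hN])
  filter_upwards [e1, e2, e3] with p hp1 hp2 hp3 hp
  simp only [Pi.mul_apply] at hp ⊢
  -- If the product lies in SU(N), so does the transversal factor, which is then 1; the product is
  -- therefore Ψ(p), an element of `S`.
  have hp' := mul_mem hp (star_mem_SU (hS hp1))
  rw [mul_assoc, mul_star_self_of_mem_SU (hS hp1), mul_one] at hp'
  have hstar : star (Λ p.2.1) = Λ p.2.1 := by
    rw [hΛ, star_add, star_star, add_comm]
  rw [eq_one_of_hermitian_mul_phase hN hstar hp2 hp3 hp', one_mul]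
  exact hp1

/-! ### From interior points to all of SU(N) -/

/-- A semigroup in `SU(N)` that contains the forward orbits of a generating set of `su(N)` is all
of `SU(N)`. -/
theorem eq_specialUnitaryGroup {S : Submonoid (Matrix (Fin N) (Fin N) ℂ)} (hN : 0 < N)
    (hS : S ≤ specialUnitaryGroup (Fin N) ℂ)
    {𝒳 : Set (Matrix (Fin N) (Fin N) ℂ)} (hX : ∀ X ∈ 𝒳, Xᴴ = -X)
    (hexp : ∀ X ∈ 𝒳, ∀ t : ℝ, 0 ≤ t → NormedSpace.exp (t • X) ∈ S)
    (hgen : ∀ L : Submodule ℝ (Matrix (Fin N) (Fin N) ℂ),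
      (∀ X ∈ L, ∀ Y ∈ L, X * Y - Y * X ∈ L) → 𝒳 ⊆ L →
      ∀ M : Matrix (Fin N) (Fin N) ℂ, Mᴴ = -M → M.trace = 0 → M ∈ L) :
    S = specialUnitaryGroup (Fin N) ℂ := by
  have : Nonempty (Fin N) := ⟨⟨0, hN⟩⟩
  obtain ⟨V, hV, hsu⟩ := exists_isVelocitySpace hS hX hexp hgen
  obtain ⟨Y₀, hY₀, hnear⟩ := hV.exists_nhds hN hS hsu
  have hY₀SU := hS hY₀
  have hone : ∀ᶠ Y in 𝓝 (1 : Matrix (Fin N) (Fin N) ℂ),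
      Y ∈ specialUnitaryGroup (Fin N) ℂ → Y ∈ S.topologicalClosure := by
    have hc : Filter.Tendsto (fun Y => Y * Y₀) (𝓝 1) (𝓝 Y₀) := by
      have : Continuous fun Y : Matrix (Fin N) (Fin N) ℂ => Y * Y₀ := by fun_prop
      simpa using this.tendsto 1
    filter_upwards [hc.eventually hnear] with Y hY hYSU
    have h1 := mul_mem (S.le_topologicalClosure (hY (mul_mem hYSU hY₀SU)))
      (star_mem_topologicalClosure hS (S.le_topologicalClosure hY₀))
    rwa [mul_assoc, mul_star_self_of_mem_SU hY₀SU, mul_one] at h1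
  -- Each Y = exp M is a power of exp(M/(n + 1)), which is near 1 for large n.
  have hdense : ∀ Y ∈ specialUnitaryGroup (Fin N) ℂ, Y ∈ S.topologicalClosure := by
    intro Y hY
    obtain ⟨M, hM, htr, rfl⟩ := exists_exp_eq hY
    have hlim : Filter.Tendsto (fun n : ℕ => NormedSpace.exp ((1 / ((n : ℝ) + 1)) • M))
        Filter.atTop (𝓝 1) := by
      have hc : ContinuousAt (fun s : ℝ => NormedSpace.exp (s • M)) 0 :=
        (hasDerivAt_exp_smul_const M (0 : ℝ)).continuousAt
      have h0 : NormedSpace.exp ((0 : ℝ) • M) = 1 := by simp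
      have := hc.tendsto.comp (tendsto_one_div_add_atTop_nhds_zero_nat (𝕜 := ℝ))
      rwa [h0] at this
    obtain ⟨n, hn⟩ := (hlim.eventually hone).exists
    have hmem := hn (exp_mem_specialUnitaryGroup
      (by rw [conjTranspose_smul, hM, star_trivial, smul_neg]) (by rw [trace_smul, htr, smul_zero]))
    have hpow := pow_mem hmem (n + 1)
    rw [← Matrix.exp_nsmul, ← Nat.cast_smul_eq_nsmul ℝ, smul_smul] at hpow
    have h1 : ((n + 1 : ℕ) : ℝ) * (1 / ((n : ℝ) + 1)) = 1 := by
      push_cast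
      field_simp
    rwa [h1, one_smul] at hpow
  -- By density some r in `S` is so close to Y Y₀* that r* Y lies in the neighbourhood of Y₀
  -- contained in `S`; then Y = r (r* Y).
  refine le_antisymm hS fun Y hY => ?_
  have hc : Filter.Tendsto (fun r => star r * Y) (𝓝 (Y * star Y₀)) (𝓝 Y₀) := by
    have h1 : Continuous fun r : Matrix (Fin N) (Fin N) ℂ => star r * Y := by fun_prop
    have h2 := h1.tendsto (Y * star Y₀)
    rwa [star_mul, star_star, mul_assoc, star_mul_self_of_mem_SU hY, mul_one] at h2
  have hcl := hdense _ (mul_mem hY (star_mem_SU hY₀SU))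
  obtain ⟨r, hr1, hr2⟩ := mem_closure_iff_nhds.1 hcl _ (hc.eventually hnear)
  have h3 := mul_mem hr2 (hr1 (mul_mem (star_mem_SU (hS hr2)) hY))
  rwa [← mul_assoc, mul_star_self_of_mem_SU (hS hr2), one_mul] at h3

lemma isControllable_of_connected_regularPart {E : Fin N → ℝ} (hEtrace : ∑ i, E i = 0)
    (hE : ∀ i j : Fin N, i ≠ j → E i ≠ E j) {B : Matrix (Fin N) (Fin N) ℂ} (hBskew : Bᴴ = -B)
    (hBtrace : B.trace = 0)
    (hG : (graph (regularPartB (touchedRoots B) (drift E) B) ⊔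
      graph (regularPartC (touchedRoots B) (drift E) B)).Connected) :
    IsControllable (drift E) B := by
  obtain ⟨o⟩ := hG.nonempty
  have hskew : ∀ u : ℝ, (drift E + u • B)ᴴ = -(drift E + u • B) := by
    intro u
    rw [conjTranspose_add, conjTranspose_smul, drift_conjTranspose, hBskew, star_trivial]
    simp [add_comm]
  have htr : ∀ u : ℝ, (drift E + u • B).trace = 0 := by
    intro u
    have : (drift E).trace = 0 := by
      rw [drift, trace_smul, trace_diagonal, ← Complex.ofReal_sum, hEtrace]
      simp
    rw [trace_add, trace_smul, hBtrace, this]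
    simp
  have h := eq_specialUnitaryGroup (S := reachableSubmonoid (drift E) B) o.pos
    (fun Y hY => hY.1) (𝒳 := Set.range fun u : ℝ => drift E + u • B)
    (by rintro _ ⟨u, rfl⟩; exact hskew u)
    (by rintro _ ⟨u, rfl⟩ t ht; exact exp_mem_reachableSet u (hskew u) (htr u) ht)
    (by
      intro L hL hsub M hM hMtr
      -- The inputs u = 0 and u = 1 already recover A and B.
      have hA : drift E ∈ L := by simpa using hsub ⟨0, rfl⟩
      have hAB : drift E + B ∈ L := by simpa using hsub ⟨1, rfl⟩
      have hB : B ∈ L := by simpa using L.sub_mem hAB hA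
      exact mem_of_connected_regularPart L hL hE hBskew hA hB hG hM hMtr)
  exact congrArg (SetLike.coe : Submonoid (Matrix (Fin N) (Fin N) ℂ) → Set (Matrix (Fin N) (Fin N) ℂ)) h

end QuantumControl

end

theorem mainTheorem7 {N : ℕ} (E : Fin N → ℝ) (hEtrace : ∑ i, E i = 0)
    (hE : ∀ i j : Fin N, i ≠ j → E i ≠ E j)
    (A B H1 : Matrix (Fin N) (Fin N) ℂ) (hH1 : H1.IsHermitian) (hH1trace : H1.trace = 0)
    (hA : A = QuantumControl.drift E) (hB : B = -Complex.I • H1)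
    (hG : (QuantumControl.graph B).Connected) :
    ((QuantumControl.graph (QuantumControl.regularPartB (QuantumControl.roots N) A B) ⊔
        QuantumControl.graph (QuantumControl.regularPartC (QuantumControl.roots N) A B)).Connected →
      QuantumControl.IsControllable A B) ∧
    ((QuantumControl.graph (QuantumControl.regularPartB (QuantumControl.touchedRoots B) A B) ⊔
        QuantumControl.graph
          (QuantumControl.regularPartC (QuantumControl.touchedRoots B) A B)).Connected →
      QuantumControl.IsControllable A B) := by
  have hBskew : Bᴴ = -B := by
    rw [hB, Matrix.conjTranspose_smul, hH1.eq]
    simp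
  have hBtrace : B.trace = 0 := by rw [hB, Matrix.trace_smul, hH1trace, smul_zero]
  have hmain := fun h => QuantumControl.isControllable_of_connected_regularPart
    hEtrace hE hBskew hBtrace h
  rw [← hA] at hmain
  exact ⟨fun h => hmain (h.mono (QuantumControl.graph_regularPart_mono A B)), hmain⟩
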